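/- Let $f\colon\{0,1\}^*\rightharpoonup\{0,1\}$ be a partial function that is monotone, i.e. $f(x)\le f(y)$ whenever $x\le y$ coordinatewise, $|x|=|y|$, and both values are defined. Suppose that $U=f^{-1}(0)$ and $V=f^{-1}(1)$ are in NP. For $n\ge 1$ let $f_n$ be the restriction of $f$ to $\{0,1\}^n$. A protocol of degree 2 with equality is a finite directed acyclic graph with exactly one vertex $v_0$ of in-degree zero (the source), in which every vertex has out-degree at most 2, together with sets $F_v\subseteq\{0,1\}^n\times\{0,1\}^n$ for the vertices $v$ such that (i) for each $v$ there are functions $q_v,r_v\colon\{0,1\}^n\to\mathbb{R}$ with $(x,y)\in F_v\Leftrightarrow q_v(x)=r_v(y)$ for all $x,y$, and (ii) for each sink $\ell$ there is an index $i$ with $(x,y)\in F_\ell\Leftrightarrow x_i=0\wedge y_i=1$ for all $x,y$. It solves $f_n$ if for all $x\in f_n^{-1}(0)$ and $y\in f_n^{-1}(1)$ we have $(x,y)\in F_{v_0}$, and whenever $v$ is not a sink and $(x,y)\in F_v$, some child $u$ of $v$ has $(x,y)\in F_u$. Its size is the number of its vertices. R(LIN) works with clauses that are finite sets of linear polynomials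 over $\mathbb{F}_2$, read as disjunctions. A refutation of a CNF formula starts from its clauses, in which each literal $\neg x_i$ is replaced by $1+x_i$, and derives the empty clause by the rules: from $C\cup\{0\}$ infer $C$; from $C\cup\{g\}$ and $D\cup\{h\}$ infer $C\cup D\cup\{g+h+1\}$. It is a sequence of clauses (dag-like), and its lines are the members of the sequence, initial clauses included. Then there are CNF formulas $\alpha^f_n$ ($n\ge 1$) of size $n^{O(1)}$ (at most $c\,n^k$ for constants $c,k$ depending only on $f$) such that for every $n\ge 1$ a protocol of degree 2 with equality solving $f_n$ exists, $\alpha^f_n$ has an R(LIN)-refutation, and every R(LIN)-refutation of $\alpha^f_n$ has at least $s(n)$ lines, where $s(n)$ is the minimum size of a protocol of degree 2 with equality solving $f_n$. -/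

import Mathlib

namespace RLin

/-! ### Nondeterministic Turing machines and NP -/

/-- A nondeterministic Turing machine with one two-way infinite tape. The alphabet `Symbol`
contains the blank `encode none` and the two input symbols `encode (some b)`. -/
structure NTM where
  State : Type
  Symbol : Type
  finState : Finite State
  finSymbol : Finite Symbol
  encode : Option Bool ↪ Symbol
  start : State
  accept : State
  trans : State → Symbol → Set (State × Symbol × Turing.Dir)

namespace NTM

/-- A configuration: the state, the position of the head, the content of the tape. -/
structure Cfg (M : NTM) where
  state : M.State
  pos : ℤ
  tape : ℤ → M.Symbol

/-- The initial configuration: the word `w` stands in the cells `0, …, |w| - 1`, all other cells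
are blank, and the head is on cell `0`. -/
def init (M : NTM) (w : List Bool) : M.Cfg where
  state := M.start
  pos := 0
  tape := fun i => M.encode (if 0 ≤ i then w[i.toNat]? else none)

/-- `M.Step c c'`: the machine can pass from `c` to `c'` in one step. -/
def Step (M : NTM) (c c' : M.Cfg) : Prop :=
  ∃ (q : M.State) (a : M.Symbol) (dir : Turing.Dir),
    (q, a, dir) ∈ M.trans c.state (c.tape c.pos) ∧
    c'.state = q ∧
    c'.tape = Function.update c.tape c.pos a ∧
    c'.pos = (match dir with
      | Turing.Dir.left => c.pos - 1
      | Turing.Dir.right => c.pos + 1)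

/-- Some computation of `M` on input `w` reaches the accepting state in at most `T` steps. -/
def AcceptsWithin (M : NTM) (w : List Bool) (T : ℕ) : Prop :=
  ∃ (t : ℕ) (c : ℕ → M.Cfg), t ≤ T ∧ c 0 = M.init w ∧
    (∀ i < t, M.Step (c i) (c (i + 1))) ∧ (c t).state = M.accept

end NTM

/-- The language `L` belongs to NP: some nondeterministic Turing machine accepts exactly the words
of `L`, and it does so in polynomial time. -/
def IsNP (L : Set (List Bool)) : Prop :=
  ∃ (M : NTM) (p : Polynomial ℕ), ∀ w : List Bool, w ∈ L ↔ M.AcceptsWithin w (p.eval w.length)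

/-! ### Partial monotone functions -/

/-- The restriction of a partial function on binary words to the words of length `n`. -/
def restrict (f : List Bool →. Bool) (n : ℕ) : (Fin n → Bool) →. Bool :=
  fun x => f (List.ofFn x)

/-- A partial Boolean function of `n` variables is monotone if it is so on its domain. -/
def IsMonotone {n : ℕ} (f : (Fin n → Bool) →. Bool) : Prop :=
  ∀ x y : Fin n → Bool, x ≤ y → ∀ a ∈ f x, ∀ b ∈ f y, a ≤ b

/-! ### Protocols -/

/-- A protocol of degree `d` with feasibility relation `F`, on a finite directed acyclic graph;
`children v` is the set of heads of the edges that leave `v`. -/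
structure Protocol (n d : ℕ) where
  V : Type
  fintypeV : Fintype V
  children : V → Finset V
  acyclic : ∀ v, ¬ Relation.TransGen (fun u w => w ∈ children u) v v
  source : V
  eq_source_iff : ∀ v, v = source ↔ ∀ u, v ∉ children u
  degree_le : ∀ v, (children v).card ≤ d
  F : (Fin n → Bool) → (Fin n → Bool) → V → Prop
  sink : ∀ v, children v = ∅ → ∃ i : Fin n, ∀ x y, F x y v ↔ (x i = false ∧ y i = true)

namespace Protocol

/-- The size of a protocol: the number of vertices. -/
def size {n d : ℕ} (P : Protocol n d) : ℕ :=
  @Fintype.card P.V P.fintypeV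

/-- The protocol solves the monotone Karchmer–Wigderson game for `f`. -/
def Solves {n d : ℕ} (P : Protocol n d) (f : (Fin n → Bool) →. Bool) : Prop :=
  ∀ x y : Fin n → Bool, false ∈ f x → true ∈ f y →
    P.F x y P.source ∧
    ∀ v, (P.children v).Nonempty → P.F x y v → ∃ u ∈ P.children v, P.F x y u

/-- The protocol is a protocol with equality. -/
def WithEquality {n d : ℕ} (P : Protocol n d) : Prop :=
  ∀ v, ∃ q r : (Fin n → Bool) → ℝ, ∀ x y, P.F x y v ↔ q x = r y

end Protocol

/-- The sizes of the protocols of degree 2 with equality that solve `f`. -/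
def equalityProtocolSizes {n : ℕ} (f : (Fin n → Bool) →. Bool) : Set ℕ :=
  {s | ∃ P : Protocol n 2, P.WithEquality ∧ P.Solves f ∧ P.size = s}

/-! ### CNF formulas and the proof system R(LIN) -/

/-- CNF formulas in the variables `x₀, x₁, …`, as finite sets of clauses; a clause is a finite set
of literals, where `(i, true)` is the literal `xᵢ` and `(i, false)` is the literal `¬xᵢ`. -/
abbrev CNF : Type := Finset (Finset (ℕ × Bool))

/-- The size of a CNF formula: the number of occurrences of literals plus the number of clauses. -/
def CNF.size (φ : CNF) : ℕ :=
  ∑ C ∈ φ, (C.card + 1)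

/-- A clause of R(LIN): a finite set of polynomials over `𝔽₂`, read as their disjunction. -/
abbrev LinClause : Type := Finset (MvPolynomial ℕ (ZMod 2))

/-- The linear polynomial of a literal: `xᵢ` for `xᵢ`, and `1 + xᵢ` for `¬xᵢ`. -/
noncomputable def literalPoly (l : ℕ × Bool) : MvPolynomial ℕ (ZMod 2) :=
  if l.2 then MvPolynomial.X l.1 else 1 + MvPolynomial.X l.1

/-- The R(LIN)-clauses of a CNF formula. -/
noncomputable def linClauses (φ : CNF) : Finset LinClause :=
  φ.image fun C => C.image literalPoly

/-- The contraction rule: from `C, 0` infer `C`. -/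
def Contraction (A C : LinClause) : Prop :=
  A = insert 0 C

/-- The addition rule: from `C, g` and `D, h` infer `C, D, g + h + 1`. -/
def Addition (A B E : LinClause) : Prop :=
  ∃ (C D : LinClause) (g h : MvPolynomial ℕ (ZMod 2)),
    A = insert g C ∧ B = insert h D ∧ E = insert (g + h + 1) (C ∪ D)

/-- An R(LIN)-refutation of `φ`: a sequence of `len + 1` clauses of linear polynomials that ends
in the empty clause, each of which is a clause of `φ` or follows from earlier ones by a rule. -/
structure Refutation (φ : CNF) where
  len : ℕ
  line : Fin (len + 1) → LinClause
  linear : ∀ j, ∀ f ∈ line j, f.totalDegree ≤ 1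
  derived : ∀ j, line j ∈ linClauses φ ∨
    (∃ i, i < j ∧ Contraction (line i) (line j)) ∨
    (∃ i k, i < j ∧ k < j ∧ Addition (line i) (line k) (line j))
  last_empty : line (Fin.last len) = ∅

/-- The number of lines of a refutation. -/
def Refutation.numLines {φ : CNF} (π : Refutation φ) : ℕ :=
  π.len + 1

/-- The numbers of lines of the R(LIN)-refutations of `φ`. -/
def refutationLengths (φ : CNF) : Set ℕ :=
  {m | ∃ π : Refutation φ, π.numLines = m}

end RLin

namespace RLin

/-! This is monotone feasible interpolation, with equality protocols playing the role that
communication games play for resolution. By Cook–Levin, membership of `x` in `U` and of `y` in `V`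
is expressed by polynomial-size CNFs `φ(x, z)` and `ψ(y, w)` (`exists_cnf_of_isNP`). On disjoint
variables, together with the clauses `xᵢ ∨ ¬yᵢ`, they form `interpolationCNF`. A satisfying
assignment would give `y ≤ x` with `f y = 1` and `f x = 0`, so monotonicity makes the formula
unsatisfiable, and R(LIN), which simulates resolution, refutes it.

Conversely, fix witnesses `s x` and `t y` for all inputs. A refutation becomes a protocol whose
vertices are its lines, read from the empty clause backwards: `(x, y)` is feasible at a line when
the joint assignment falsifies it. The empty clause is always falsified, soundness of the rules
passes falsity to a premise, and the only initial clauses that can be falsified are `xᵢ ∨ ¬yᵢ`,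
which yield `xᵢ = 0`, `yᵢ = 1` (`exists_protocol_of_refutation`). Falsity means that all polynomials
of the line vanish; each is affine, so its value splits into a part from `x` and a part from `y`,
and the condition is one equality between a function of `x` and a function of `y`
(`exists_falsified_add_iff`). -/

/-- The assignment `z` satisfies the CNF formula `φ`. -/
def CNF.Satisfies (φ : CNF) (z : ℕ → Bool) : Prop :=
  ∀ C ∈ φ, ∃ l ∈ C, z l.1 = l.2

theorem CNF.size_union_le (φ ψ : CNF) : CNF.size (φ ∪ ψ) ≤ φ.size + ψ.size := by
  have h := Finset.sum_union_inter (s₁ := φ) (s₂ := ψ)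
    (f := fun C : Finset (ℕ × Bool) => C.card + 1)
  unfold CNF.size
  omega

theorem CNF.size_biUnion_le {ι : Type*} [DecidableEq ι] (s : Finset ι) (φ : ι → CNF) :
    CNF.size (s.biUnion φ) ≤ ∑ i ∈ s, (φ i).size := by
  induction s using Finset.induction_on with
  | empty => simp [CNF.size]
  | insert a s ha ih =>
    rw [Finset.biUnion_insert, Finset.sum_insert ha]
    exact (CNF.size_union_le _ _).trans (Nat.add_le_add_left ih _)

theorem CNF.size_image_le {ι : Type*} (s : Finset ι) (C : ι → Finset (ℕ × Bool)) :
    CNF.size (s.image C) ≤ ∑ i ∈ s, ((C i).card + 1) := by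
  classical
  rw [← Finset.biUnion_singleton]
  refine (CNF.size_biUnion_le _ _).trans_eq (Finset.sum_congr rfl fun i _ => ?_)
  exact Finset.sum_singleton _ _

/-! ### Local constraints as CNF formulas -/

open Classical in
/-- The CNF formula, in the variables `S`, of a predicate that depends only on these. -/
noncomputable def constraintCNF (S : Finset ℕ) (P : (ℕ → Bool) → Prop) : CNF :=
  (S.powerset.filter fun R => ¬ P fun v => decide (v ∈ R)).image
    fun R => S.image fun v => (v, !decide (v ∈ R))

/-- Each clause excludes exactly one assignment of `S`, namely one that violates `P`; `hP` says that
the values on `S` decide `P`. -/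
theorem satisfies_constraintCNF {S : Finset ℕ} {P : (ℕ → Bool) → Prop}
    (hP : ∀ z z' : ℕ → Bool, (∀ v ∈ S, z v = z' v) → P z → P z') (z : ℕ → Bool) :
    (constraintCNF S P).Satisfies z ↔ P z := by
  classical
  constructor
  · intro h
    by_contra hz
    have hR : ∀ v ∈ S, decide (v ∈ S.filter fun v => z v = true) = z v := by
      intro v hv
      simp [hv]
    obtain ⟨l, hl, hzl⟩ := h (S.image fun v => (v, !decide (v ∈ S.filter fun v => z v = true))) <| by
      refine Finset.mem_image.2 ⟨S.filter fun v => z v = true, ?_, ?_⟩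
      · rw [Finset.mem_filter, Finset.mem_powerset]
        exact ⟨Finset.filter_subset _ _, fun h => hz (hP _ _ hR h)⟩
      · exact Finset.image_congr fun v _ => by congr
    obtain ⟨v, hv, rfl⟩ := Finset.mem_image.1 hl
    dsimp only at hzl
    rw [hR v hv] at hzl
    simp at hzl
  · intro hz C hC
    obtain ⟨R, hR, rfl⟩ := Finset.mem_image.1 hC
    by_contra! hne
    refine (Finset.mem_filter.1 hR).2 (hP _ _ (fun v hv => ?_) hz)
    have := hne _ (Finset.mem_image_of_mem _ hv)
    dsimp only at this
    cases h1 : z v <;> cases h2 : decide (v ∈ R) <;> simp_all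

theorem size_constraintCNF_le (S : Finset ℕ) (P : (ℕ → Bool) → Prop) :
    (constraintCNF S P).size ≤ 2 ^ S.card * (S.card + 1) := by
  classical
  refine (CNF.size_image_le _ _).trans ((Finset.sum_le_card_nsmul _ _ (S.card + 1)
    fun R _ => Nat.succ_le_succ Finset.card_image_le).trans ?_)
  refine Nat.mul_le_mul_right _ ((Finset.card_filter_le _ _).trans ?_)
  rw [Finset.card_powerset]

/-! ### Accepting computations as tableaux -/

namespace NTM

/-- The content of a cell of a tableau. A tableau has a row for each time; the rows are shifted so
that the head is at place `0`. The transition that is made at that time is repeated in each cell. -/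
structure Cell (M : NTM) where
  state : M.State
  symbol : M.Symbol
  write : M.Symbol
  right : Bool

instance (M : NTM) : Finite M.Cell := by
  have := M.finState
  have := M.finSymbol
  refine Finite.of_injective (β := M.State × M.Symbol × M.Symbol × Bool)
    (fun c => (c.state, c.symbol, c.write, c.right)) ?_
  rintro ⟨⟩ ⟨⟩ h
  simpa using h

instance (M : NTM) : Nonempty M.Cell :=
  ⟨⟨M.start, M.encode none, M.encode none, true⟩⟩

/-- The displacement of the head. -/
def shift (b : Bool) : ℤ := if b then 1 else -1

/-- The direction of the movement of the head. -/
def dir (b : Bool) : Turing.Dir := if b then Turing.Dir.right else Turing.Dir.left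

/-- The condition that a tableau `D` with first row `a` and last row `T` has to fulfil at time `t`
and place `i`. -/
def Local (M : NTM) (T : ℕ) (a : ℤ → M.Symbol) (D : ℕ → ℤ → M.Cell) (t : ℕ) (i : ℤ) : Prop :=
  (t = 0 → (D t i).symbol = a i ∧ (D t 0).state = M.start) ∧
  (t = T → (D t 0).state = M.accept) ∧
  -- The first alternative pads a computation that accepts early; from then on only the state is
  -- constrained.
  (t < T → ((D t 0).state = M.accept ∧ (D (t + 1) 0).state = M.accept) ∨
    (((D (t + 1) 0).state, (D t 0).write, dir (D t 0).right) ∈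
        M.trans (D t 0).state (D t 0).symbol ∧
      (D (t + 1) i).symbol = if i + shift (D t 0).right = 0 then (D t 0).write
        else (D t (i + shift (D t 0).right)).symbol))

/-- The computation that follows the transitions of a tableau. -/
def follow (M : NTM) (w : List Bool) (D : ℕ → ℤ → M.Cell) : ℕ → M.Cfg
  | 0 => M.init w
  | t + 1 =>
    { state := (D (t + 1) 0).state
      pos := (follow M w D t).pos + shift (D t 0).right
      tape := Function.update (follow M w D t).tape (follow M w D t).pos (D t 0).write }

/-- Centring each row at the head makes the head position implicit, so every condition involves a
bounded number of cells. -/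
theorem acceptsWithin_iff_exists_tableau (M : NTM) (w : List Bool) (T : ℕ) :
    M.AcceptsWithin w T ↔ ∃ D : ℕ → ℤ → M.Cell, ∀ t ≤ T, ∀ i : ℤ, |i| ≤ T →
      M.Local T (M.init w).tape D t i := by
  classical
  constructor
  · rintro ⟨t₀, c, ht₀, h0, hstep, hacc⟩
    have hex : ∀ t, ∃ (a : M.Symbol) (b : Bool), t < t₀ →
        ((c (t + 1)).state, a, dir b) ∈ M.trans (c t).state ((c t).tape (c t).pos) ∧
        (c (t + 1)).tape = Function.update (c t).tape (c t).pos a ∧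
        (c (t + 1)).pos = (c t).pos + shift b := by
      intro t
      by_cases ht : t < t₀
      · obtain ⟨q, a, d, h1, h2, h3, h4⟩ := hstep t ht
        cases d with
        | left => exact ⟨a, false, fun _ => ⟨by simpa [h2, dir] using h1, h3, h4⟩⟩
        | right => exact ⟨a, true, fun _ => ⟨by simpa [h2, dir] using h1, h3, h4⟩⟩
      · exact ⟨M.encode none, true, fun h => absurd h ht⟩
    choose a b hab using hex
    refine ⟨fun t i => ⟨if t ≤ t₀ then (c t).state else M.accept, (c t).tape ((c t).pos + i), a t,
      b t⟩, fun t _ i _ => ⟨?_, ?_, ?_⟩⟩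
    · rintro rfl
      simp [h0, init]
    · rintro rfl
      dsimp only
      split_ifs with h
      · rwa [show t = t₀ by omega]
      · rfl
    · intro _
      dsimp only
      rcases lt_or_ge t t₀ with ht | ht
      · right
        obtain ⟨h1, h2, h3⟩ := hab t ht
        rw [if_pos ht.le, if_pos (Nat.succ_le_of_lt ht), add_zero]
        refine ⟨h1, ?_⟩
        rw [h2, h3, Function.update_apply]
        refine if_congr (by constructor <;> intro h <;> linarith) rfl ?_
        congr 1
        ring
      · left
        refine ⟨?_, by rw [if_neg (by omega)]⟩
        split_ifs with h
        · rwa [show t = t₀ by omega]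
        · rfl
  · rintro ⟨D, hD⟩
    have h0 : (|(0 : ℤ)| : ℤ) ≤ T := by simp
    -- Before the first accepting time the padding alternative is impossible, so the tableau encodes
    -- genuine steps up to then.
    have hex : ∃ t, (D t 0).state = M.accept := ⟨T, (hD T le_rfl 0 h0).2.1 rfl⟩
    have hT : Nat.find hex ≤ T := Nat.find_min' hex ((hD T le_rfl 0 h0).2.1 rfl)
    have hstate : ∀ t, (M.follow w D t).state = (D t 0).state := by
      rintro (_ | t)
      · exact ((hD 0 T.zero_le 0 h0).1 rfl).2.symm
      · rfl
    have hnext : ∀ t < Nat.find hex, ∀ i : ℤ, |i| ≤ T → _ := fun t ht i hi =>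
      ((hD t (ht.le.trans hT) i hi).2.2 (ht.trans_le hT)).resolve_left
        fun h => Nat.find_min hex ht h.1
    -- The window shrinks by one place per step, because the tableau is constrained only for `|i| ≤
    -- T` and each row looks one place aside in the previous one.
    have htape : ∀ t ≤ Nat.find hex, ∀ i : ℤ, |i| + t ≤ T →
        (M.follow w D t).tape ((M.follow w D t).pos + i) = (D t i).symbol := by
      intro t
      induction t with
      | zero =>
        intro _ i hi
        have : |i| ≤ T := by simpa using hi
        rw [((hD 0 T.zero_le i this).1 rfl).1]
        simp [follow, init]
      | succ t ih =>
        intro ht i hi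
        push_cast at hi
        have hs : |i + shift (D t 0).right| + t ≤ T := by
          have : |shift (D t 0).right| ≤ 1 := by
            unfold shift
            split_ifs <;> simp
          have := abs_add_le i (shift (D t 0).right)
          linarith
        rw [(hnext t ht i (by linarith [(Nat.cast_nonneg t : (0 : ℤ) ≤ t)])).2,
          ← ih (by omega) _ hs]
        simp only [follow, Function.update_apply]
        refine if_congr (by constructor <;> intro h <;> linarith) rfl ?_
        congr 1
        ring
    refine ⟨Nat.find hex, M.follow w D, hT, rfl, fun t ht => ?_, ?_⟩
    · refine ⟨_, _, dir (D t 0).right, (?_ : ((D (t + 1) 0).state, (D t 0).write, _) ∈ _),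
        rfl, rfl, ?_⟩
      · have h := htape t ht.le 0 (by simpa using ht.le.trans hT)
        rw [add_zero] at h
        rw [h, hstate]
        exact (hnext t ht 0 h0).1
      · cases h : (D t 0).right <;> simp [follow, shift, dir, h, sub_eq_add_neg]
    · rw [hstate]
      exact Nat.find_spec hex

end NTM

/-- Since `dec` is total, every bit pattern denotes a cell and no clauses are needed to enforce
valid codes. -/
theorem exists_bool_code (α : Type*) [Finite α] [Nonempty α] :
    ∃ (B : ℕ) (enc : α → Fin B → Bool) (dec : (Fin B → Bool) → α), ∀ a, dec (enc a) = a := by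
  classical
  obtain ⟨B, ⟨e⟩⟩ := Finite.exists_equiv_fin α
  have hinj : Function.Injective fun (a : α) (i : Fin B) => decide (e a = i) := by
    intro a b h
    have := congrFun h (e b)
    simpa using this
  exact ⟨B, _, Function.invFun _, Function.leftInverse_invFun hinj⟩

/-! ### Languages in NP have polynomial-size CNF descriptions -/

/-- The variable that holds bit `i` of the input. -/
def inputVar (i : ℕ) : ℕ := Encodable.encode (Sum.inl i : ℕ ⊕ ℕ × ℤ × ℕ)

/-- The variable that holds bit `b` of the tableau cell at time `t` and place `i`. -/
def cellVar (t : ℕ) (i : ℤ) (b : ℕ) : ℕ := Encodable.encode (Sum.inr (t, i, b) : ℕ ⊕ ℕ × ℤ × ℕ)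

theorem exists_assignment (x : ℕ → Bool) (y : ℕ → ℤ → ℕ → Bool) :
    ∃ z : ℕ → Bool, (∀ i, z (inputVar i) = x i) ∧ ∀ t i b, z (cellVar t i b) = y t i b := by
  refine ⟨fun k => (Encodable.decode (α := ℕ ⊕ ℕ × ℤ × ℕ) k).elim false
    (Sum.elim x fun p => y p.1 p.2.1 p.2.2), fun i => ?_, fun t i b => ?_⟩
  · simp only [inputVar, Encodable.encodek, Option.elim_some, Sum.elim_inl]
  · simp only [cellVar, Encodable.encodek, Option.elim_some, Sum.elim_inr]

/-- The variables on which the condition at time `t` and place `i` depends. -/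
def localVars (B t : ℕ) (i : ℤ) : Finset ℕ :=
  insert (inputVar i.toNat) <|
    (({(t, 0), (t, i), (t, i + 1), (t, i + -1), (t + 1, i), (t + 1, 0)} : Finset (ℕ × ℤ)) ×ˢ
      Finset.range B).image fun p => cellVar p.1.1 p.1.2 p.2

theorem card_localVars_le (B t : ℕ) (i : ℤ) : (localVars B t i).card ≤ 6 * B + 1 := by
  refine (Finset.card_insert_le _ _).trans (Nat.succ_le_succ (Finset.card_image_le.trans ?_))
  rw [Finset.card_product, Finset.card_range]
  exact Nat.mul_le_mul_right _ Finset.card_le_six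

/-- The first row of the tableau, read off an assignment of the variables. -/
def firstRow (M : NTM) (n : ℕ) (z : ℕ → Bool) (i : ℤ) : M.Symbol :=
  M.encode (if 0 ≤ i then (if i.toNat < n then some (z (inputVar i.toNat)) else none) else none)

theorem firstRow_eq (M : NTM) {n : ℕ} {z : ℕ → Bool} {x : Fin n → Bool}
    (h : ∀ i : Fin n, z (inputVar i) = x i) :
    firstRow M n z = (M.init (List.ofFn x)).tape := by
  funext i
  simp only [firstRow, NTM.init]
  congr 1
  refine if_congr Iff.rfl ?_ rfl
  rw [List.getElem?_ofFn]
  split_ifs with hi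
  · rw [← h ⟨i.toNat, hi⟩]
  · rfl

/-- The Cook–Levin argument: there are `(p + 1)(2p + 1)` places in the tableau, and the condition at
each depends on at most `6B + 1` variables, with `B` fixed by the machine. -/
theorem exists_cnf_of_isNP {L : Set (List Bool)} (hL : IsNP L) :
    ∃ (φ : ℕ → CNF) (Q : Polynomial ℕ), ∀ n, (φ n).size ≤ Q.eval n ∧
      ∀ x : Fin n → Bool, List.ofFn x ∈ L ↔
        ∃ z : ℕ → Bool, (∀ i : Fin n, z (inputVar i) = x i) ∧ (φ n).Satisfies z := by
  obtain ⟨M, p, hM⟩ := hL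
  obtain ⟨B, enc, dec, hdec⟩ := exists_bool_code M.Cell
  let D : (ℕ → Bool) → ℕ → ℤ → M.Cell := fun z t i => dec fun b => z (cellVar t i b)
  let P : ℕ → ℕ × ℤ → (ℕ → Bool) → Prop := fun n q z =>
    M.Local (p.eval n) (firstRow M n z) (D z) q.1 q.2
  let I : ℕ → Finset (ℕ × ℤ) := fun n =>
    Finset.range (p.eval n + 1) ×ˢ Finset.Icc (-((p.eval n : ℕ) : ℤ)) ((p.eval n : ℕ) : ℤ)
  let φ : ℕ → CNF := fun n => (I n).biUnion fun q => constraintCNF (localVars B q.1 q.2) (P n q)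
  have hP : ∀ n q (z z' : ℕ → Bool), (∀ v ∈ localVars B q.1 q.2, z v = z' v) →
      P n q z → P n q z' := by
    rintro n ⟨t, i⟩ z z' hz
    have hcell : ∀ s j, (s, j) ∈ ({(t, 0), (t, i), (t, i + 1), (t, i + -1), (t + 1, i),
        (t + 1, 0)} : Finset (ℕ × ℤ)) → D z s j = D z' s j := by
      intro s j hsj
      refine congrArg dec (funext fun b => hz _ (Finset.mem_insert_of_mem ?_))
      exact Finset.mem_image.2 ⟨((s, j), b), Finset.mem_product.2 ⟨hsj, Finset.mem_range.2 b.2⟩, rfl⟩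
    have h1 : firstRow M n z i = firstRow M n z' i := by
      simp only [firstRow, hz _ (Finset.mem_insert_self _ _)]
    have h2 : ∀ b, D z t (i + NTM.shift b) = D z' t (i + NTM.shift b) := by
      intro b
      cases b <;> exact hcell _ _ (by simp [NTM.shift])
    simp only [P, NTM.Local, h1, h2, hcell t 0 (by simp), hcell t i (by simp),
      hcell (t + 1) i (by simp), hcell (t + 1) 0 (by simp)]
    exact id
  have hφ : ∀ n z, (φ n).Satisfies z ↔ ∀ t ≤ p.eval n, ∀ i : ℤ, |i| ≤ (p.eval n : ℕ) → P n (t, i) z := by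
    intro n z
    have : (φ n).Satisfies z ↔ ∀ q ∈ I n, P n q z := by
      simp only [← satisfies_constraintCNF (hP n _) z]
      simp only [φ, CNF.Satisfies, Finset.mem_biUnion]
      constructor
      · exact fun h q hq C hC => h C ⟨q, hq, hC⟩
      · rintro h C ⟨q, hq, hC⟩
        exact h q hq C hC
    rw [this]
    simp only [I, Prod.forall, Finset.mem_product, Finset.mem_range, Finset.mem_Icc, ← abs_le,
      Nat.lt_succ_iff]
    exact ⟨fun h t ht i hi => h t i ⟨ht, hi⟩, fun h t i hti => h t hti.1 i hti.2⟩
  refine ⟨φ, (p + 1) * (2 * p + 1) *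
    Polynomial.C (2 ^ (6 * B + 1) * (6 * B + 1 + 1)), fun n => ⟨?_, fun x => ?_⟩⟩
  · refine (CNF.size_biUnion_le _ _).trans ((Finset.sum_le_card_nsmul _ _
      (2 ^ (6 * B + 1) * (6 * B + 1 + 1)) fun q _ => ?_).trans_eq ?_)
    · refine (size_constraintCNF_le _ _).trans ?_
      have := card_localVars_le B q.1 q.2
      gcongr
      norm_num
    · simp only [I, smul_eq_mul, Finset.card_product, Finset.card_range, Int.card_Icc, Polynomial.eval_mul,
        Polynomial.eval_add, Polynomial.eval_one, Polynomial.eval_C, Polynomial.eval_ofNat]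
      congr 2
      omega
  · rw [hM, List.length_ofFn, NTM.acceptsWithin_iff_exists_tableau]
    constructor
    · rintro ⟨E, hE⟩
      obtain ⟨z, hz1, hz2⟩ := exists_assignment (fun i => if h : i < n then x ⟨i, h⟩ else false)
        (fun t i b => if h : b < B then enc (E t i) ⟨b, h⟩ else false)
      have hx : ∀ i : Fin n, z (inputVar i) = x i := fun i => by simp [hz1]
      have hDE : D z = E := by
        funext t i
        simp [D, hz2, hdec]
      refine ⟨z, hx, (hφ n z).2 fun t ht i hi => ?_⟩
      simp only [P, firstRow_eq M hx, hDE]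
      exact hE t ht i hi
    · rintro ⟨z, hx, hz⟩
      refine ⟨D z, fun t ht i hi => ?_⟩
      have := (hφ n z).1 hz t ht i hi
      simpa only [P, firstRow_eq M hx] using this


/-! ### Completeness of R(LIN) -/

/-- The clauses that R(LIN) derives from a CNF formula. -/
inductive Derivable (φ : CNF) : LinClause → Prop
  | mem {C} : C ∈ linClauses φ → Derivable φ C
  | contraction {A C} : Derivable φ A → Contraction A C → Derivable φ C
  | addition {A B E} : Derivable φ A → Derivable φ B → Addition A B E → Derivable φ E

theorem totalDegree_literalPoly_le (l : ℕ × Bool) : (literalPoly l).totalDegree ≤ 1 := by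
  unfold literalPoly
  split_ifs
  · exact (MvPolynomial.totalDegree_X _).le
  · refine (MvPolynomial.totalDegree_add _ _).trans ?_
    simp

theorem Derivable.totalDegree_le {φ : CNF} {C : LinClause} (h : Derivable φ C) :
    ∀ g ∈ C, g.totalDegree ≤ 1 := by
  induction h with
  | mem h =>
    obtain ⟨D, _, rfl⟩ := Finset.mem_image.1 h
    intro g hg
    obtain ⟨l, _, rfl⟩ := Finset.mem_image.1 hg
    exact totalDegree_literalPoly_le l
  | contraction _ h ih =>
    intro g hg
    rw [h] at ih
    exact ih g (Finset.mem_insert_of_mem hg)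
  | addition _ _ h ihA ihB =>
    obtain ⟨C, D, g, h, rfl, rfl, rfl⟩ := h
    intro f hf
    rcases Finset.mem_insert.1 hf with rfl | hf
    · refine (MvPolynomial.totalDegree_add _ _).trans (max_le ?_ (by simp))
      exact (MvPolynomial.totalDegree_add _ _).trans
        (max_le (ihA g (Finset.mem_insert_self _ _)) (ihB h (Finset.mem_insert_self _ _)))
    · rcases Finset.mem_union.1 hf with hf | hf
      · exact ihA f (Finset.mem_insert_of_mem hf)
      · exact ihB f (Finset.mem_insert_of_mem hf)

/-- Each of the first `N` clauses of a sequence is a clause of `φ` or follows from earlier ones. -/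
def IsDerivation (φ : CNF) (line : ℕ → LinClause) (N : ℕ) : Prop :=
  ∀ j < N, line j ∈ linClauses φ ∨ (∃ i < j, Contraction (line i) (line j)) ∨
    ∃ i < j, ∃ k < j, Addition (line i) (line k) (line j)

theorem IsDerivation.snoc {φ : CNF} {line : ℕ → LinClause} {N : ℕ} (h : IsDerivation φ line N)
    {E : LinClause} (hE : E ∈ linClauses φ ∨ (∃ i < N, Contraction (line i) E) ∨
      ∃ i < N, ∃ k < N, Addition (line i) (line k) E) :
    ∃ line', IsDerivation φ line' (N + 1) ∧ line' N = E ∧ ∀ j < N, line' j = line j := by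
  have hlt : ∀ j < N, Function.update line N E j = line j := fun j hj =>
    Function.update_of_ne hj.ne _ _
  refine ⟨Function.update line N E, fun j hj => ?_, Function.update_self .., hlt⟩
  rcases Nat.lt_succ_iff_lt_or_eq.1 hj with hj | rfl
  · rw [hlt j hj]
    refine (h j hj).imp_right (Or.imp ?_ ?_)
    · rintro ⟨i, hi, hc⟩
      exact ⟨i, hi, by rwa [hlt i (hi.trans hj)]⟩
    · rintro ⟨i, hi, k, hk, hc⟩
      exact ⟨i, hi, k, hk, by rwa [hlt i (hi.trans hj), hlt k (hk.trans hj)]⟩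
  · rw [Function.update_self]
    refine hE.imp_right (Or.imp ?_ ?_)
    · rintro ⟨i, hi, hc⟩
      exact ⟨i, hi, by rwa [hlt i hi]⟩
    · rintro ⟨i, hi, k, hk, hc⟩
      exact ⟨i, hi, k, hk, by rwa [hlt i hi, hlt k hk]⟩

/-- Quantifying over an arbitrary existing prefix lets the derivation of a second premise be
appended to that of the first. -/
theorem Derivable.exists_derivation {φ : CNF} {C : LinClause} (h : Derivable φ C) :
    ∀ (line : ℕ → LinClause) (N : ℕ), IsDerivation φ line N →
      ∃ line' N', IsDerivation φ line' N' ∧ N ≤ N' ∧ (∀ j < N, line' j = line j) ∧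
        ∃ i < N', line' i = C := by
  induction h with
  | mem h =>
    intro line N hl
    obtain ⟨l, h1, h2, h3⟩ := hl.snoc (Or.inl h)
    exact ⟨l, N + 1, h1, N.le_succ, h3, N, N.lt_succ_self, h2⟩
  | contraction _ h ih =>
    intro line N hl
    obtain ⟨l, N₁, h1, h2, h3, i, hi, rfl⟩ := ih line N hl
    obtain ⟨l', h1', h2', h3'⟩ := h1.snoc (Or.inr (Or.inl ⟨i, hi, h⟩))
    exact ⟨l', N₁ + 1, h1', by omega, fun j hj => (h3' j (by omega)).trans (h3 j hj), N₁,
      by omega, h2'⟩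
  | addition _ _ h ihA ihB =>
    intro line N hl
    obtain ⟨l, N₁, h1, h2, h3, i, hi, rfl⟩ := ihA line N hl
    obtain ⟨l', N₂, h1', h2', h3', k, hk, rfl⟩ := ihB l N₁ h1
    rw [← h3' i hi] at h
    obtain ⟨l'', h1'', h2'', h3''⟩ :=
      h1'.snoc (Or.inr (Or.inr ⟨i, hi.trans_le h2', k, hk, h⟩))
    exact ⟨l'', N₂ + 1, h1'', by omega, fun j hj => (h3'' j (by omega)).trans
      ((h3' j (by omega)).trans (h3 j hj)), N₂, by omega, h2''⟩

theorem IsDerivation.derivable {φ : CNF} {line : ℕ → LinClause} {N : ℕ}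
    (h : IsDerivation φ line N) : ∀ j < N, Derivable φ (line j) := by
  intro j
  induction j using Nat.strong_induction_on with
  | _ j ih =>
    intro hj
    rcases h j hj with hC | ⟨i, hi, hC⟩ | ⟨i, hi, k, hk, hC⟩
    · exact .mem hC
    · exact .contraction (ih i hi (hi.trans hj)) hC
    · exact .addition (ih i hi (hi.trans hj)) (ih k hk (hk.trans hj)) hC

theorem Derivable.nonempty_refutation {φ : CNF} (h : Derivable φ ∅) : Nonempty (Refutation φ) := by
  obtain ⟨line, N, hl, -, -, m, hm, hC⟩ :=
    h.exists_derivation (fun _ => ∅) 0 fun j hj => absurd hj j.not_lt_zero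
  refine ⟨⟨m, fun j => line j, fun j => (hl.derivable j (by omega)).totalDegree_le, fun j => ?_, hC⟩⟩
  refine (hl j (by omega)).imp_right (Or.imp ?_ ?_)
  · rintro ⟨i, hi, hc⟩
    exact ⟨⟨i, by omega⟩, hi, hc⟩
  · rintro ⟨i, hi, k, hk, hc⟩
    exact ⟨⟨i, by omega⟩, ⟨k, by omega⟩, hi, hk, hc⟩

/-- Resolution is addition followed by contraction, as `x + (1 + x) + 1 = 0` over `𝔽₂`. -/
theorem Derivable.resolve {φ : CNF} {C D : Finset (ℕ × Bool)} {v : ℕ}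
    (hC : Derivable φ (C.image literalPoly)) (hD : Derivable φ (D.image literalPoly))
    (hvC : (v, true) ∈ C) (hvD : (v, false) ∈ D) :
    Derivable φ ((C.erase (v, true) ∪ D.erase (v, false)).image literalPoly) := by
  refine .contraction (.addition hC hD ⟨(C.erase (v, true)).image literalPoly,
    (D.erase (v, false)).image literalPoly, literalPoly (v, true), literalPoly (v, false), ?_, ?_,
    rfl⟩) ?_
  · rw [← Finset.image_insert, Finset.insert_erase hvC]
  · rw [← Finset.image_insert, Finset.insert_erase hvD]
  · have h : literalPoly (v, true) + literalPoly (v, false) + 1 = 0 := by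
      have h2 : (2 : MvPolynomial ℕ (ZMod 2)) = 0 := CharTwo.two_eq_zero
      simp only [literalPoly, if_true, Bool.false_eq_true, if_false]
      linear_combination (MvPolynomial.X v + 1) * h2
    rw [h, Finset.image_union]
    rfl

/-- Variables are eliminated from the largest down. The invariant is that every assignment falsifies
some derivable clause in the variables below `N`; at `N = 0` that clause is empty. -/
theorem derivable_empty_of_unsatisfiable {φ : CNF} (h : ∀ z, ¬ φ.Satisfies z) :
    Derivable φ ∅ := by
  have key : ∀ N : ℕ, (∀ z : ℕ → Bool, ∃ C : Finset (ℕ × Bool), (∀ l ∈ C, l.1 < N) ∧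
      (∀ l ∈ C, z l.1 ≠ l.2) ∧ Derivable φ (C.image literalPoly)) → Derivable φ ∅ := by
    intro N
    induction N with
    | zero =>
      intro hN
      obtain ⟨C, h1, -, h3⟩ := hN fun _ => true
      rwa [Finset.eq_empty_of_forall_notMem fun l hl => (h1 l hl).not_ge (Nat.zero_le _),
        Finset.image_empty] at h3
    | succ N ih =>
      refine fun hN => ih fun z => ?_
      -- The only literal on `N` that the value `b` falsifies is `(N, !b)`; if it is absent from the
      -- clause, `N` does not occur. Otherwise the clauses for both values of `N` are resolved.
      have hlit : ∀ (b : Bool) (C : Finset (ℕ × Bool)), (∀ l ∈ C, l.1 < N + 1) →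
          (∀ l ∈ C, Function.update z N b l.1 ≠ l.2) →
          ∀ l ∈ C, l ≠ (N, !b) → l.1 < N ∧ z l.1 ≠ l.2 := by
        intro b C h1 h2 l hl hne
        have hlN : l.1 ≠ N := by
          intro hlN
          have := h2 l hl
          rw [hlN, Function.update_self] at this
          exact hne (Prod.ext hlN (by cases b <;> cases h : l.2 <;> simp_all))
        have := h2 l hl
        rw [Function.update_of_ne hlN] at this
        exact ⟨by have := h1 l hl; omega, this⟩
      obtain ⟨C, hC1, hC2, hC3⟩ := hN (Function.update z N false)
      obtain ⟨D, hD1, hD2, hD3⟩ := hN (Function.update z N true)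
      have hC := hlit false C hC1 hC2
      have hD := hlit true D hD1 hD2
      by_cases hvC : (N, true) ∈ C
      · by_cases hvD : (N, false) ∈ D
        · have hE : ∀ l ∈ C.erase (N, true) ∪ D.erase (N, false), l.1 < N ∧ z l.1 ≠ l.2 := by
            intro l hl
            rcases Finset.mem_union.1 hl with hl | hl
            · exact hC l (Finset.mem_of_mem_erase hl) (Finset.ne_of_mem_erase hl)
            · exact hD l (Finset.mem_of_mem_erase hl) (Finset.ne_of_mem_erase hl)
          exact ⟨_, fun l hl => (hE l hl).1, fun l hl => (hE l hl).2, hC3.resolve hD3 hvC hvD⟩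
        · have hE := fun l hl => hD l hl fun h => hvD (h ▸ hl)
          exact ⟨D, fun l hl => (hE l hl).1, fun l hl => (hE l hl).2, hD3⟩
      · have hE := fun l hl => hC l hl fun h => hvC (h ▸ hl)
        exact ⟨C, fun l hl => (hE l hl).1, fun l hl => (hE l hl).2, hC3⟩
  refine key (φ.sup (fun C => C.sup Prod.fst) + 1) fun z => ?_
  have hz := h z
  simp only [CNF.Satisfies, not_forall, not_exists, not_and] at hz
  obtain ⟨C, hC, hzC⟩ := hz
  refine ⟨C, fun l hl => Nat.lt_succ_of_le ?_, hzC, .mem (Finset.mem_image_of_mem _ hC)⟩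
  exact (Finset.le_sup (f := Prod.fst) hl).trans
    (Finset.le_sup (f := fun C : Finset (ℕ × Bool) => C.sup Prod.fst) hC)


/-! ### Protocols on well-founded numberings -/

/-- A directed graph on `0, …, m` with edges to smaller vertices becomes a protocol with source `m`
once the vertices that cannot be reached from `m` are removed. -/
theorem exists_protocol_of_children {n m : ℕ} {f : (Fin n → Bool) →. Bool}
    (ch : Fin (m + 1) → Finset (Fin (m + 1))) (hlt : ∀ j, ∀ i ∈ ch j, i < j)
    (hcard : ∀ j, (ch j).card ≤ 2) (F : (Fin n → Bool) → (Fin n → Bool) → Fin (m + 1) → Prop)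
    (hsink : ∀ j, ch j = ∅ → ∃ i : Fin n, ∀ x y, F x y j ↔ (x i = false ∧ y i = true))
    (heq : ∀ j, ∃ q r : (Fin n → Bool) → ℝ, ∀ x y, F x y j ↔ q x = r y)
    (hsolves : ∀ x y, false ∈ f x → true ∈ f y → F x y (Fin.last m) ∧
      ∀ j, (ch j).Nonempty → F x y j → ∃ i ∈ ch j, F x y i) :
    ∃ P : Protocol n 2, P.WithEquality ∧ P.Solves f ∧ P.size ≤ m + 1 := by
  classical
  let p : Fin (m + 1) → Prop := fun j =>
    Relation.ReflTransGen (fun u w => w ∈ ch u) (Fin.last m) j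
  have hp : ∀ {j i}, p j → i ∈ ch j → p i := fun hj hi => Relation.ReflTransGen.tail hj hi
  have hempty : ∀ v : Subtype p, (ch v).subtype p = ∅ → ch v = ∅ := by
    intro v hv
    refine Finset.eq_empty_of_forall_notMem fun i hi => ?_
    have : (⟨i, hp v.2 hi⟩ : Subtype p) ∈ (ch v).subtype p := Finset.mem_subtype.2 hi
    rw [hv] at this
    exact Finset.notMem_empty _ this
  let P : Protocol n 2 :=
    { V := Subtype p
      fintypeV := inferInstance
      children := fun v => (ch v).subtype p
      acyclic := by
        intro v hv
        have key : ∀ u w : Subtype p,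
            Relation.TransGen (fun u w : Subtype p => w ∈ (ch u).subtype p) u w → w.1 < u.1 := by
          intro u w h
          induction h with
          | single h => exact hlt _ _ (Finset.mem_subtype.1 h)
          | tail _ h ih => exact (hlt _ _ (Finset.mem_subtype.1 h)).trans ih
        exact lt_irrefl _ (key v v hv)
      source := ⟨Fin.last m, Relation.ReflTransGen.refl⟩
      eq_source_iff := by
        intro v
        constructor
        · rintro rfl u hu
          exact (hlt _ _ (Finset.mem_subtype.1 hu)).not_ge (Fin.le_last _)
        · intro h
          rcases Relation.ReflTransGen.cases_tail v.2 with h' | ⟨b, hb, hbv⟩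
          · exact Subtype.ext h'
          · exact absurd (Finset.mem_subtype.2 hbv) (h ⟨b, hb⟩)
      degree_le := by
        intro v
        rw [Finset.card_subtype]
        exact (Finset.card_filter_le _ _).trans (hcard v)
      F := fun x y v => F x y v
      sink := fun v hv => hsink v (hempty v hv) }
  refine ⟨P, fun v => heq v.1, fun x y hx hy => ?_, ?_⟩
  · obtain ⟨h1, h2⟩ := hsolves x y hx hy
    refine ⟨h1, fun v hv hF => ?_⟩
    obtain ⟨u, hu⟩ := hv
    obtain ⟨i, hi, hFi⟩ := h2 v.1 ⟨u.1, Finset.mem_subtype.1 hu⟩ hF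
    exact ⟨⟨i, hp v.2 hi⟩, Finset.mem_subtype.2 hi, hFi⟩
  · refine (Fintype.card_subtype_le p).trans_eq ?_
    simp

/-! ### Falsified clauses -/

/-- The assignment `z` as a point over `𝔽₂`. -/
def point (z : ℕ → Bool) (v : ℕ) : ZMod 2 := if z v then 1 else 0

/-- Every member of the clause `C` vanishes at the point `a`. -/
def Falsified (C : LinClause) (a : ℕ → ZMod 2) : Prop :=
  ∀ g ∈ C, MvPolynomial.eval a g = 0

theorem eval_literalPoly_eq_zero (z : ℕ → Bool) (l : ℕ × Bool) :
    MvPolynomial.eval (point z) (literalPoly l) = 0 ↔ z l.1 ≠ l.2 := by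
  have h2 : (1 + 1 : ZMod 2) = 0 := by decide
  rcases l with ⟨v, b⟩
  cases b <;> cases h : z v <;> simp [literalPoly, point, h, h2]

theorem not_falsified_of_satisfies {φ : CNF} {z : ℕ → Bool} (h : φ.Satisfies z)
    {C : LinClause} (hC : C ∈ linClauses φ) : ¬ Falsified C (point z) := by
  obtain ⟨D, hD, rfl⟩ := Finset.mem_image.1 hC
  obtain ⟨l, hl, hzl⟩ := h D hD
  exact fun hF => (eval_literalPoly_eq_zero z l).1 (hF _ (Finset.mem_image_of_mem _ hl)) hzl

theorem Contraction.falsified {A C : LinClause} (h : Contraction A C) {a : ℕ → ZMod 2}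
    (hC : Falsified C a) : Falsified A a := by
  rw [Contraction] at h
  rw [h]
  intro g hg
  rcases Finset.mem_insert.1 hg with rfl | hg
  · exact map_zero _
  · exact hC g hg

/-- Over `𝔽₂`, `g + h + 1 = 0` forces exactly one of `g`, `h` to vanish. -/
theorem Addition.falsified {A B E : LinClause} (h : Addition A B E) {a : ℕ → ZMod 2}
    (hE : Falsified E a) : Falsified A a ∨ Falsified B a := by
  obtain ⟨C, D, g, h, rfl, rfl, rfl⟩ := h
  have hCD : ∀ k ∈ C ∪ D, MvPolynomial.eval a k = 0 := fun k hk =>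
    hE k (Finset.mem_insert_of_mem hk)
  have hgh := hE _ (Finset.mem_insert_self _ _)
  rw [map_add, map_add, map_one] at hgh
  have key : ∀ s t : ZMod 2, s + t + 1 = 0 → s = 0 ∨ t = 0 := by decide
  refine (key _ _ hgh).imp (fun h0 k hk => ?_) (fun h0 k hk => ?_)
  · rcases Finset.mem_insert.1 hk with rfl | hk
    · exact h0
    · exact hCD k (Finset.mem_union_left _ hk)
  · rcases Finset.mem_insert.1 hk with rfl | hk
    · exact h0
    · exact hCD k (Finset.mem_union_right _ hk)

/-- A monomial of degree at most one is a constant or a variable, and the identity holds for both.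
-/
theorem eval_add_point {σ R : Type*} [CommRing R] {g : MvPolynomial σ R} (hg : g.totalDegree ≤ 1)
    (a b : σ → R) : MvPolynomial.eval (a + b) g + MvPolynomial.eval 0 g =
      MvPolynomial.eval a g + MvPolynomial.eval b g := by
  classical
  simp only [MvPolynomial.eval_eq, ← Finset.sum_add_distrib, ← mul_add]
  refine Finset.sum_congr rfl fun d hd => congrArg _ ?_
  have hdeg : d.degree ≤ 1 := (MvPolynomial.le_totalDegree hd).trans hg
  rcases Nat.le_one_iff_eq_zero_or_eq_one.1 hdeg with h | h
  · rw [Finsupp.degree_eq_zero_iff] at h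
    simp [h]
  · obtain ⟨i, rfl⟩ := (Finsupp.sum_eq_one_iff d).1 h
    simp

/-- For points `a x + b y`, falsity of a clause of linear polynomials is an equality between a
function of `x` and a function of `y`. -/
theorem exists_falsified_add_iff {X Y : Type*} {C : LinClause} (hC : ∀ g ∈ C, g.totalDegree ≤ 1)
    (a : X → ℕ → ZMod 2) (b : Y → ℕ → ZMod 2) :
    ∃ (q : X → ℝ) (r : Y → ℝ), ∀ x y, Falsified C (a x + b y) ↔ q x = r y := by
  -- The vector of values on the finite clause is coded by one natural number, so a single real
  -- equality compares all coordinates.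
  obtain ⟨e, he⟩ := Countable.exists_injective_nat (C → ZMod 2)
  refine ⟨fun x => e fun g => MvPolynomial.eval (a x) g.1,
    fun y => e fun g => MvPolynomial.eval 0 g.1 - MvPolynomial.eval (b y) g.1, fun x y => ?_⟩
  rw [Nat.cast_inj, he.eq_iff, funext_iff, Subtype.forall]
  refine forall₂_congr fun g hg => ?_
  have h := eval_add_point (hC g hg) (a x) (b y)
  constructor <;> intro h'
  · linear_combination h' - h
  · linear_combination h' + h

theorem exists_pair_eq_iff {n : ℕ} (i : Fin n) :
    ∃ q r : (Fin n → Bool) → ℝ, ∀ x y, (x i = false ∧ y i = true) ↔ q x = r y := by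
  -- The ranges `{0, 1}` and `{0, 2}` meet only in `0`, attained at `xᵢ = 0` and at `yᵢ = 1`.
  refine ⟨fun x => if x i then 1 else 0, fun y => if y i then 0 else 2, fun x y => ?_⟩
  cases h : x i <;> cases h' : y i <;> simp [h, h']

/-! ### The formulas and their interpolation -/

/-- The formula `φ` with its variables renamed by `e`. -/
def CNF.rename (e : ℕ → ℕ) (φ : CNF) : CNF :=
  φ.image fun C => C.image fun l => (e l.1, l.2)

theorem CNF.satisfies_rename (e : ℕ → ℕ) (φ : CNF) (z : ℕ → Bool) :
    (φ.rename e).Satisfies z ↔ φ.Satisfies (z ∘ e) := by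
  simp [CNF.Satisfies, CNF.rename]

theorem CNF.size_rename_le (e : ℕ → ℕ) (φ : CNF) : (φ.rename e).size ≤ φ.size :=
  (CNF.size_image_le _ _).trans
    (Finset.sum_le_sum fun _ _ => Nat.succ_le_succ Finset.card_image_le)

/-- The formula `φ(x, z) ∧ ψ(y, w) ∧ ⋀ᵢ (yᵢ → xᵢ)`. -/
def interpolationCNF (n : ℕ) (φ ψ : CNF) : CNF :=
  φ.rename (fun v => 2 * v) ∪ ψ.rename (fun v => 2 * v + 1) ∪
    Finset.univ.image fun i : Fin n =>
      {(2 * inputVar i, true), (2 * inputVar i + 1, false)}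

theorem size_interpolationCNF_le (n : ℕ) (φ ψ : CNF) :
    (interpolationCNF n φ ψ).size ≤ φ.size + ψ.size + n * 3 := by
  refine (CNF.size_union_le _ _).trans (add_le_add ((CNF.size_union_le _ _).trans
    (add_le_add (CNF.size_rename_le _ _) (CNF.size_rename_le _ _))) ?_)
  refine (CNF.size_image_le _ _).trans ((Finset.sum_le_card_nsmul _ _ 3
    fun i _ => Nat.succ_le_succ Finset.card_le_two).trans_eq ?_)
  simp

/-- The assignment that is `s` on the even and `t` on the odd variables. -/
def interleave (s t : ℕ → Bool) (v : ℕ) : Bool := if v % 2 = 0 then s (v / 2) else t (v / 2)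

theorem interleave_even (s t : ℕ → Bool) (v : ℕ) : interleave s t (2 * v) = s v := by
  simp [interleave]

theorem interleave_odd (s t : ℕ → Bool) (v : ℕ) : interleave s t (2 * v + 1) = t v := by
  rw [interleave, if_neg (by omega), show (2 * v + 1) / 2 = v by omega]

/-- The two summands have disjoint supports. This brings the joint assignment into the form `a x + b
y`. -/
theorem point_interleave (s t : ℕ → Bool) :
    point (interleave s t) = point (interleave s fun _ => false) +
      point (interleave (fun _ => false) t) := by
  funext v
  simp only [point, interleave, Pi.add_apply]
  split_ifs <;> simp_all

section Interpolation

variable {n : ℕ} {f : (Fin n → Bool) →. Bool} {φ ψ : CNF}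

theorem not_satisfies_interpolationCNF (hf : IsMonotone f)
    (hφ : ∀ x, false ∈ f x ↔ ∃ z : ℕ → Bool, (∀ i : Fin n, z (inputVar i) = x i) ∧ φ.Satisfies z)
    (hψ : ∀ y, true ∈ f y ↔ ∃ z : ℕ → Bool, (∀ i : Fin n, z (inputVar i) = y i) ∧ ψ.Satisfies z)
    (z : ℕ → Bool) : ¬ (interpolationCNF n φ ψ).Satisfies z := by
  intro hz
  have hzφ : (φ.rename fun v => 2 * v).Satisfies z := fun C hC =>
    hz C (Finset.mem_union_left _ (Finset.mem_union_left _ hC))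
  have hzψ : (ψ.rename fun v => 2 * v + 1).Satisfies z := fun C hC =>
    hz C (Finset.mem_union_left _ (Finset.mem_union_right _ hC))
  rw [CNF.satisfies_rename] at hzφ hzψ
  have hx := (hφ fun i => z (2 * inputVar i)).2 ⟨_, fun _ => rfl, hzφ⟩
  have hy := (hψ fun i => z (2 * inputVar i + 1)).2 ⟨_, fun _ => rfl, hzψ⟩
  have hle : (fun i : Fin n => z (2 * inputVar i + 1)) ≤ fun i : Fin n => z (2 * inputVar i) := by
    intro i
    obtain ⟨l, hl, hzl⟩ := hz _ (Finset.mem_union_right _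
      (Finset.mem_image_of_mem _ (Finset.mem_univ i)))
    rcases Finset.mem_insert.1 hl with rfl | hl
    · dsimp only at hzl ⊢
      rw [hzl]
      exact Bool.le_true _
    · rw [Finset.mem_singleton.1 hl] at hzl
      dsimp only at hzl ⊢
      rw [hzl]
      exact Bool.false_le _
  exact absurd (hf _ _ hle _ hy _ hx) (by decide)

/-- The witnesses `s x` and `t y` are chosen independently of each other, which is what separates
the dependence on `x` from that on `y`. -/
theorem exists_protocol_of_refutation (hn : 1 ≤ n)
    (hφ : ∀ x, false ∈ f x → ∃ z : ℕ → Bool, (∀ i : Fin n, z (inputVar i) = x i) ∧ φ.Satisfies z)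
    (hψ : ∀ y, true ∈ f y → ∃ z : ℕ → Bool, (∀ i : Fin n, z (inputVar i) = y i) ∧ ψ.Satisfies z)
    (π : Refutation (interpolationCNF n φ ψ)) :
    ∃ P : Protocol n 2, P.WithEquality ∧ P.Solves f ∧ P.size ≤ π.numLines := by
  classical
  have hs : ∀ x, ∃ z : ℕ → Bool, false ∈ f x →
      (∀ i : Fin n, z (inputVar i) = x i) ∧ φ.Satisfies z := fun x => by
    by_cases hx : false ∈ f x
    · exact (hφ x hx).imp fun z hz _ => hz
    · exact ⟨fun _ => false, fun h => absurd h hx⟩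
  have ht : ∀ y, ∃ z : ℕ → Bool, true ∈ f y →
      (∀ i : Fin n, z (inputVar i) = y i) ∧ ψ.Satisfies z := fun y => by
    by_cases hy : true ∈ f y
    · exact (hψ y hy).imp fun z hz _ => hz
    · exact ⟨fun _ => false, fun h => absurd h hy⟩
  choose s hs using hs
  choose t ht using ht
  let α := interpolationCNF n φ ψ
  let Fal : (Fin n → Bool) → (Fin n → Bool) → LinClause → Prop := fun x y C =>
    Falsified C (point (interleave (s x) (t y)))
  have hinit : ∀ j, ∃ i : Fin n, π.line j ∈ linClauses α → ∀ x y, false ∈ f x → true ∈ f y →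
      Fal x y (π.line j) → x i = false ∧ y i = true := by
    intro j
    by_cases hj : π.line j ∈ linClauses α
    · obtain ⟨D, hD, hDj⟩ := Finset.mem_image.1 hj
      rcases Finset.mem_union.1 hD with hD | hD
      -- Clauses of `φ` and `ψ` are satisfied by the witnesses, so any index serves; `hn` supplies
      -- one.
      · refine ⟨⟨0, hn⟩, fun _ x y hx hy hF => absurd hF ?_⟩
        have hsx := (hs x hx).2
        have hty := (ht y hy).2
        rw [← hDj]
        rcases Finset.mem_union.1 hD with hD | hD
        · refine not_falsified_of_satisfies ((CNF.satisfies_rename _ φ _).2 ?_)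
            (Finset.mem_image_of_mem _ hD)
          rwa [show interleave (s x) (t y) ∘ (fun v => 2 * v) = s x from
            funext fun v => interleave_even (s x) (t y) v]
        · refine not_falsified_of_satisfies ((CNF.satisfies_rename _ ψ _).2 ?_)
            (Finset.mem_image_of_mem _ hD)
          rwa [show interleave (s x) (t y) ∘ (fun v => 2 * v + 1) = t y from
            funext fun v => interleave_odd (s x) (t y) v]
      · obtain ⟨i, -, rfl⟩ := Finset.mem_image.1 hD
        refine ⟨i, fun _ x y hx hy hF => ?_⟩
        rw [← hDj] at hF
        have h1 := (eval_literalPoly_eq_zero _ _).1 (hF _ (Finset.mem_image_of_mem _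
          (Finset.mem_insert_self _ _)))
        have h2 := (eval_literalPoly_eq_zero _ _).1 (hF _ (Finset.mem_image_of_mem _
          (Finset.mem_insert_of_mem (Finset.mem_singleton_self _))))
        dsimp only at h1 h2
        rw [interleave_even, (hs x hx).1] at h1
        rw [interleave_odd, (ht y hy).1] at h2
        exact ⟨by simpa using h1, by simpa using h2⟩
    · exact ⟨⟨0, hn⟩, fun h => absurd h hj⟩
  choose idx hidx using hinit
  have hch : ∀ j, ∃ c : Finset (Fin (π.len + 1)), (∀ i ∈ c, i < j) ∧ c.card ≤ 2 ∧
      (c = ∅ ↔ π.line j ∈ linClauses α) ∧ (π.line j ∉ linClauses α → ∀ x y,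
        Fal x y (π.line j) → ∃ i ∈ c, Fal x y (π.line i)) := by
    intro j
    by_cases hj : π.line j ∈ linClauses α
    · exact ⟨∅, by simp, by simp, by simpa using hj, fun h => absurd hj h⟩
    · rcases (π.derived j).resolve_left hj with ⟨i, hi, hc⟩ | ⟨i, k, hi, hk, hc⟩
      · exact ⟨{i}, by simpa using hi, by simp, by simpa using hj, fun _ x y hF =>
          ⟨i, Finset.mem_singleton_self i, hc.falsified hF⟩⟩
      · refine ⟨{i, k}, by simp [hi, hk], Finset.card_le_two,
          iff_of_false (Finset.insert_ne_empty _ _) hj, fun _ x y hF => ?_⟩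
        rcases hc.falsified hF with h | h
        · exact ⟨i, by simp, h⟩
        · exact ⟨k, by simp, h⟩
  choose ch hlt hcard hempty hchild using hch
  -- A sink must satisfy its equivalence for all `x`, `y`, even off the domain of `f`. So falsity of
  -- an initial clause is replaced by the condition on `idx j`, which it implies for the relevant
  -- pairs.
  let F : (Fin n → Bool) → (Fin n → Bool) → Fin (π.len + 1) → Prop := fun x y j =>
    if π.line j ∈ linClauses α then x (idx j) = false ∧ y (idx j) = true else Fal x y (π.line j)
  have hF : ∀ x y j, false ∈ f x → true ∈ f y → Fal x y (π.line j) → F x y j := by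
    intro x y j hx hy h
    by_cases hj : π.line j ∈ linClauses α
    · simpa only [F, if_pos hj] using hidx j hj x y hx hy h
    · simpa only [F, if_neg hj] using h
  refine exists_protocol_of_children ch hlt hcard F (fun j hj => ⟨idx j, fun x y => ?_⟩)
    (fun j => ?_) fun x y hx hy => ⟨hF _ _ _ hx hy ?_, fun j hj hFj => ?_⟩
  · simp only [F, if_pos ((hempty j).1 hj)]
  · by_cases hj : π.line j ∈ linClauses α
    · simpa only [F, if_pos hj] using exists_pair_eq_iff (idx j)
    · simp only [F, if_neg hj, Fal, point_interleave (s _) (t _)]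
      exact exists_falsified_add_iff (π.linear j) _ _
  · simp only [Fal, π.last_empty]
    exact fun g hg => absurd hg (Finset.notMem_empty g)
  · have hj' : π.line j ∉ linClauses α := fun h => hj.ne_empty ((hempty j).2 h)
    simp only [F, if_neg hj'] at hFj
    obtain ⟨i, hi, h⟩ := hchild j hj' x y hFj
    exact ⟨i, hi, hF _ _ _ hx hy h⟩

end Interpolation

theorem exists_isLeast_of_nonempty {S : Set ℕ} (h : S.Nonempty) : ∃ s, IsLeast S s :=
  ⟨sInf S, Nat.sInf_mem h, fun _ => Nat.sInf_le⟩

theorem exists_eval_le_mul_pow (Q : Polynomial ℕ) :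
    ∃ c k : ℕ, ∀ n, 1 ≤ n → Q.eval n ≤ c * n ^ k := by
  -- `Q.eval 1` is the sum of the coefficients, and `n ^ i ≤ n ^ natDegree` for `n ≥ 1`.
  refine ⟨Q.eval 1, Q.natDegree, fun n hn => ?_⟩
  rw [Polynomial.eval_eq_sum_range, Polynomial.eval_eq_sum_range, Finset.sum_mul]
  refine Finset.sum_le_sum fun i hi => ?_
  rw [one_pow, mul_one]
  exact Nat.mul_le_mul_left _ (Nat.pow_le_pow_right hn (Nat.lt_succ_iff.1 (Finset.mem_range.1 hi)))

end RLin

theorem mainTheorem4 (f : List Bool →. Bool)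
    (hmono : ∀ n, RLin.IsMonotone (RLin.restrict f n))
    (hU : RLin.IsNP (f.preimage {false}))
    (hV : RLin.IsNP (f.preimage {true})) :
    ∃ (α : ℕ → RLin.CNF) (c k : ℕ), ∀ n : ℕ, 1 ≤ n →
      (α n).size ≤ c * n ^ k ∧
      ∃ s m : ℕ,
        IsLeast (RLin.equalityProtocolSizes (RLin.restrict f n)) s ∧
        IsLeast (RLin.refutationLengths (α n)) m ∧
        s ≤ m := by
  obtain ⟨φ, Q, hφ⟩ := RLin.exists_cnf_of_isNP hU
  obtain ⟨ψ, R, hψ⟩ := RLin.exists_cnf_of_isNP hV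
  obtain ⟨c, k, hck⟩ := RLin.exists_eval_le_mul_pow (Q + R + Polynomial.X * 3)
  refine ⟨fun n => RLin.interpolationCNF n (φ n) (ψ n), c, k, fun n hn => ⟨?_, ?_⟩⟩
  · refine (RLin.size_interpolationCNF_le _ _ _).trans (le_trans ?_ (hck n hn))
    rw [Polynomial.eval_add, Polynomial.eval_add, Polynomial.eval_mul, Polynomial.eval_X,
      Polynomial.eval_ofNat]
    exact add_le_add_left (add_le_add (hφ n).1 (hψ n).1) _
  · have hmem : ∀ b (x : Fin n → Bool), b ∈ RLin.restrict f n x ↔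
        List.ofFn x ∈ f.preimage {b} := by
      intro b x
      simp [RLin.restrict, PFun.mem_preimage]
    have hφ' := fun x => (hmem false x).trans ((hφ n).2 x)
    have hψ' := fun x => (hmem true x).trans ((hψ n).2 x)
    obtain ⟨π₀⟩ := (RLin.derivable_empty_of_unsatisfiable
      (RLin.not_satisfies_interpolationCNF (hmono n) hφ' hψ')).nonempty_refutation
    obtain ⟨m, hm⟩ := RLin.exists_isLeast_of_nonempty
      (S := RLin.refutationLengths (RLin.interpolationCNF n (φ n) (ψ n))) ⟨_, π₀, rfl⟩
    obtain ⟨π, hπ⟩ := hm.1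
    obtain ⟨P, hPe, hPs, hPm⟩ := RLin.exists_protocol_of_refutation hn (fun x => (hφ' x).1)
      (fun y => (hψ' y).1) π
    obtain ⟨s, hs⟩ := RLin.exists_isLeast_of_nonempty
      (S := RLin.equalityProtocolSizes (RLin.restrict f n)) ⟨_, P, hPe, hPs, rfl⟩
    exact ⟨s, m, hs, hm, (hs.2 ⟨P, hPe, hPs, rfl⟩).trans (hπ ▸ hPm)⟩
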